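/- **Theorem 6.1.** Let $\mathbb D=\{z\in\mathbb C:|z|<1\}$ and let $\overline{\mathbb C}=\mathbb C\cup\{\infty\}$ be the Riemann sphere with the spherical metric $d_S(z,w)=\frac{2|z-w|}{\sqrt{1+|z|^2}\sqrt{1+|w|^2}}$, $d_S(z,\infty)=\frac{2}{\sqrt{1+|z|^2}}$. For $w\in\mathbb D$ put $\varphi_w(z)=\frac{z+w}{1+z\overline w}$, and for $z,w\in\mathbb D$ let $d_{ph}(z,w)=\left|\frac{z-w}{1-z\overline w}\right|$. Let $f:\mathbb D\to\overline{\mathbb C}$ be a meromorphic function, let $c\in\overline{\mathbb C}$, and let $\gamma\subseteq\mathbb D$ be a simple curve terminating in $e^{i\theta}$, $\theta\in\mathbb R$; that is, $\gamma=p([0,1))$ for a continuous injective $p:[0,1)\to\mathbb D$ with $\lim_{t\to1}p(t)=e^{i\theta}$. Then the following conditions are equivalent: 1. $f$ is normal along $\gamma$, and $f$ has the asymptotic value $c$ along $\gamma$, i.e. $\lim_{\gamma\ni z\to e^{i\theta}}f(z)=c$; 2. $c$ is the $\Delta_\gamma$-boundary value of $f$, i.e. $C(f,\Delta_r\gamma,e^{i\theta})=\{c\}$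 for every $r\in(0,1)$. Here $f$ is *normal along $\gamma$* if $\{f\circ\varphi_w:w\in\gamma\}$ is a normal family in $\mathbb D$ in the sense of Montel: every sequence in it has a subsequence that converges, uniformly on compact subsets of $\mathbb D$ with respect to $d_S$, to some function $\mathbb D\to\overline{\mathbb C}$ (the constant $\infty$ is allowed). Further, $\Delta_r\gamma=\bigcup_{w\in\gamma}\{z\in\mathbb D:d_{ph}(z,w)\le r\}$, and for $A\subseteq\mathbb D$ the cluster set $C(f,A,e^{i\theta})$ consists of all $a\in\overline{\mathbb C}$ for which there is a sequence $(z_n)$ in $A$ with $z_n\to e^{i\theta}$ and $f(z_n)\to a$. -/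

import Mathlib

open Filter Topology
open scoped OnePoint Complex.UnitDisc

noncomputable section

namespace CurvilinearBoundary

/-- The pseudo-hyperbolic distance `|(z - w) / (1 - z * conj w)|` on the unit disc. -/
def pseudoHyperbolicDist (z w : 𝔻) : ℝ :=
  ‖((z : ℂ) - w) / (1 - (z : ℂ) * (starRingEnd ℂ) (w : ℂ))‖

/-- The spherical (chordal) metric on the Riemann sphere `OnePoint ℂ`. -/
def sphericalDist : OnePoint ℂ → OnePoint ℂ → ℝ
  | OnePoint.some z, OnePoint.some w =>
      2 * ‖z - w‖ / (Real.sqrt (1 + ‖z‖ ^ 2) * Real.sqrt (1 + ‖w‖ ^ 2))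
  | OnePoint.some z, OnePoint.infty => 2 / Real.sqrt (1 + ‖z‖ ^ 2)
  | OnePoint.infty, OnePoint.some w => 2 / Real.sqrt (1 + ‖w‖ ^ 2)
  | OnePoint.infty, OnePoint.infty => 0

theorem norm_mobius_lt_one (w z : 𝔻) :
    ‖((z : ℂ) + w) / (1 + (z : ℂ) * (starRingEnd ℂ) (w : ℂ))‖ < 1 := by
  have hz := z.normSq_lt_one
  have hw := w.normSq_lt_one
  have key : Complex.normSq ((z : ℂ) + w) <
      Complex.normSq (1 + (z : ℂ) * (starRingEnd ℂ) (w : ℂ)) := by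
    simp only [Complex.normSq_apply, Complex.add_re, Complex.add_im, Complex.mul_re,
      Complex.mul_im, Complex.conj_re, Complex.conj_im, Complex.one_re, Complex.one_im] at *
    nlinarith [mul_pos (sub_pos.2 hz) (sub_pos.2 hw)]
  have hpos : 0 < Complex.normSq (1 + (z : ℂ) * (starRingEnd ℂ) (w : ℂ)) :=
    lt_of_le_of_lt (Complex.normSq_nonneg _) key
  have hsq : ‖((z : ℂ) + w) / (1 + (z : ℂ) * (starRingEnd ℂ) (w : ℂ))‖ ^ 2 < 1 := by
    rw [← Complex.normSq_eq_norm_sq, Complex.normSq_div, div_lt_one hpos]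
    exact key
  exact (sq_lt_one_iff₀ (norm_nonneg _)).1 hsq

/-- The conformal automorphism `φ_w(z) = (z + w) / (1 + z * conj w)` of the unit disc. -/
def mobius (w z : 𝔻) : 𝔻 :=
  Complex.UnitDisc.mk (((z : ℂ) + w) / (1 + (z : ℂ) * (starRingEnd ℂ) (w : ℂ)))
    (norm_mobius_lt_one w z)

/-- Meromorphic functions from the unit disc to the Riemann sphere: `f` is continuous as a map
into the sphere, and in a punctured neighbourhood of each point it is finite and coincides with
a complex-valued function that is meromorphic at this point. The function that is
identically `∞` is not meromorphic. -/
def IsMeromorphic (f : 𝔻 → OnePoint ℂ) : Prop :=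
  Continuous f ∧
    ∀ z : 𝔻, ∃ g : ℂ → ℂ, MeromorphicAt g (z : ℂ) ∧
      ∀ᶠ w : 𝔻 in 𝓝[≠] z, f w = ((g (w : ℂ) : ℂ) : OnePoint ℂ)

/-- The set `γ` is (the trace of) a simple curve in the unit disc that terminates in the
point `ξ`: it is parametrized injectively and continuously by `[0, 1)`, and the parametrization
tends to `ξ` as the parameter tends to `1`. -/
def IsSimpleCurveEndingAt (γ : Set 𝔻) (ξ : ℂ) : Prop :=
  ∃ p : ℝ → 𝔻, ContinuousOn p (Set.Ico 0 1) ∧ Set.InjOn p (Set.Ico 0 1) ∧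
    p '' Set.Ico 0 1 = γ ∧ Tendsto (fun t => (p t : ℂ)) (𝓝[<] 1) (𝓝 ξ)

/-- The curvilinear angle `Δ_r γ`: the union of the closed pseudo-hyperbolic discs of radius `r`
with centres on `γ`. -/
def curvilinearAngle (γ : Set 𝔻) (r : ℝ) : Set 𝔻 :=
  ⋃ w ∈ γ, {z : 𝔻 | pseudoHyperbolicDist z w ≤ r}

/-- The cluster set `C(f, A, ξ)`. -/
def clusterSet (f : 𝔻 → OnePoint ℂ) (A : Set 𝔻) (ξ : ℂ) : Set (OnePoint ℂ) :=
  {a | ∃ z : ℕ → 𝔻, (∀ n, z n ∈ A) ∧ Tendsto (fun n => (z n : ℂ)) atTop (𝓝 ξ) ∧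
    Tendsto (fun n => f (z n)) atTop (𝓝 a)}

/-- `c` is the `Δ_γ`-boundary value of `f` in the endpoint `ξ` of `γ`. -/
def IsDeltaBoundaryValue (f : 𝔻 → OnePoint ℂ) (γ : Set 𝔻) (ξ : ℂ) (c : OnePoint ℂ) : Prop :=
  ∀ r ∈ Set.Ioo (0 : ℝ) 1, clusterSet f (curvilinearAngle γ r) ξ = {c}

/-- `f z` tends to `c` as `z` tends to `ξ` along `γ`. -/
def HasAsymptoticValue (f : 𝔻 → OnePoint ℂ) (γ : Set 𝔻) (ξ : ℂ) (c : OnePoint ℂ) : Prop :=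
  Tendsto f (comap (fun z : 𝔻 => (z : ℂ)) (𝓝 ξ) ⊓ 𝓟 γ) (𝓝 c)

/-- Uniform convergence, in the spherical metric, on compact subsets of the unit disc. -/
def ConvergesLocally (F : ℕ → 𝔻 → OnePoint ℂ) (g : 𝔻 → OnePoint ℂ) : Prop :=
  ∀ K : Set 𝔻, IsCompact K → ∀ ε > 0, ∃ N : ℕ, ∀ n ≥ N, ∀ z ∈ K,
    sphericalDist (F n z) (g z) < ε

/-- A normal family in the sense of Montel: every sequence in the family has a subsequence that
converges uniformly on compact subsets of the unit disc in the spherical metric. The limit may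
be any function into the sphere, for example the constant `∞`. -/
def IsNormalFamily (𝓕 : Set (𝔻 → OnePoint ℂ)) : Prop :=
  ∀ F : ℕ → 𝔻 → OnePoint ℂ, (∀ n, F n ∈ 𝓕) →
    ∃ k : ℕ → ℕ, StrictMono k ∧ ∃ g : 𝔻 → OnePoint ℂ, ConvergesLocally (fun n => F (k n)) g

/-- `f` is normal along `γ`: the functions `f ∘ φ_w`, `w ∈ γ`, form a normal family. -/
def IsNormalAlong (f : 𝔻 → OnePoint ℂ) (γ : Set 𝔻) : Prop :=
  IsNormalFamily ((fun w : 𝔻 => f ∘ mobius w) '' γ)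

end CurvilinearBoundary

end

noncomputable section

namespace CurvilinearBoundary

/-! ### The Riemann sphere as a metric space -/

/-! Let `ξ` be the endpoint of `γ` and `F_w = f ∘ φ_w`. Since `φ_w` carries `|ζ| ≤ r` onto the
pseudo-hyperbolic disc of radius `r` about `w`, and these discs shrink to `ξ` as `w → ξ`, condition
2 says that `F_w → c` locally uniformly as `w → ξ` along `γ`.

Given condition 1, let `g` be a locally uniform limit of `F_{w_n}` with `w_n → ξ` on `γ`. From `w_n`
the curve runs to the unit circle, so it crosses every pseudo-hyperbolic circle about `w_n`
(`IsSimpleCurveEndingAt.exists_mobius_mem`). The crossings tend to `ξ`, so `f → c` there, and `g`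
takes the value `c` on every circle about `0`. The identity theorem (`eq_of_frequently_eq`) gives `g
≡ c`, whence every cluster value is `c`.

Conversely, a sequence on `γ` has a subsequence tending to `ξ`, where `F_w → c`, or to a point `v`
of the disc, where `F_w → F_v` by continuity. -/

/-- The stereographic projection from the Riemann sphere to the unit sphere in `ℂ × ℝ`. -/
def stereographicEmbedding (x : OnePoint ℂ) : WithLp 2 (ℂ × ℝ) :=
  x.elim (WithLp.toLp 2 (0, 1)) fun z =>
    WithLp.toLp 2 (((2 / (1 + ‖z‖ ^ 2) : ℝ) : ℂ) * z, 1 - 2 / (1 + ‖z‖ ^ 2))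

/-- As a Euclidean chord length, the spherical distance inherits the triangle inequality. Squaring
reduces the claim to a rational identity. -/
theorem dist_stereographicEmbedding (x y : OnePoint ℂ) :
    dist (stereographicEmbedding x) (stereographicEmbedding y) = sphericalDist x y := by
  have hsq : ∀ z w : ℂ, ‖z - w‖ ^ 2 = (z.re - w.re) ^ 2 + (z.im - w.im) ^ 2 := fun z w => by
    rw [← Complex.normSq_eq_norm_sq, Complex.normSq_apply]; simp; ring
  have hsq' : ∀ z : ℂ, ‖z‖ ^ 2 = z.re ^ 2 + z.im ^ 2 := fun z => by
    rw [← Complex.normSq_eq_norm_sq, Complex.normSq_apply]; ring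
  have hnonneg : 0 ≤ sphericalDist x y := by
    induction x using OnePoint.rec <;> induction y using OnePoint.rec <;>
      simp only [sphericalDist] <;> positivity
  rw [WithLp.prod_dist_eq_of_L2, Real.sqrt_eq_iff_mul_self_eq (by positivity) hnonneg, ← sq, eq_comm]
  simp only [dist_eq_norm, Real.norm_eq_abs, sq_abs]
  induction x using OnePoint.rec with
  | infty =>
    induction y using OnePoint.rec with
    | infty => simp [sphericalDist, stereographicEmbedding]
    | coe w =>
      have hw : (0 : ℝ) < 1 + ‖w‖ ^ 2 := by positivity
      change (2 / √(1 + ‖w‖ ^ 2)) ^ 2 = _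
      rw [div_pow, Real.sq_sqrt hw.le]
      simp only [stereographicEmbedding, WithLp.toLp_fst, WithLp.toLp_snd, OnePoint.elim_infty, OnePoint.elim_some, zero_sub,
        norm_neg, norm_mul, Complex.norm_real, mul_pow, Real.norm_eq_abs, sq_abs]
      field_simp
      ring
  | coe z =>
    have hz : (0 : ℝ) < 1 + ‖z‖ ^ 2 := by positivity
    induction y using OnePoint.rec with
    | infty =>
      change (2 / √(1 + ‖z‖ ^ 2)) ^ 2 = _
      rw [div_pow, Real.sq_sqrt hz.le]
      simp only [stereographicEmbedding, WithLp.toLp_fst, WithLp.toLp_snd, OnePoint.elim_infty, OnePoint.elim_some, sub_zero,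
        norm_mul, Complex.norm_real, mul_pow, Real.norm_eq_abs, sq_abs]
      field_simp
      ring
    | coe w =>
      have hw : (0 : ℝ) < 1 + ‖w‖ ^ 2 := by positivity
      change (2 * ‖z - w‖ / (√(1 + ‖z‖ ^ 2) * √(1 + ‖w‖ ^ 2))) ^ 2 = _
      rw [div_pow, mul_pow, mul_pow, Real.sq_sqrt hz.le, Real.sq_sqrt hw.le]
      simp only [stereographicEmbedding, WithLp.toLp_fst, WithLp.toLp_snd, OnePoint.elim_some, hsq, Complex.re_ofReal_mul,
        Complex.im_ofReal_mul]
      rw [hsq' z] at hz ⊢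
      rw [hsq' w] at hw ⊢
      field_simp
      ring

theorem eq_of_sphericalDist_eq_zero {x y : OnePoint ℂ} (h : sphericalDist x y = 0) : x = y := by
  have hpos : ∀ z : ℂ, √(1 + ‖z‖ ^ 2) ≠ 0 := fun z => (Real.sqrt_pos.2 (by positivity)).ne'
  induction x using OnePoint.rec with
  | infty =>
    induction y using OnePoint.rec with
    | infty => rfl
    | coe w =>
      change 2 / √(1 + ‖w‖ ^ 2) = 0 at h
      simp [hpos] at h
  | coe z =>
    induction y using OnePoint.rec with
    | infty =>
      change 2 / √(1 + ‖z‖ ^ 2) = 0 at h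
      simp [hpos] at h
    | coe w =>
      change 2 * ‖z - w‖ / (√(1 + ‖z‖ ^ 2) * √(1 + ‖w‖ ^ 2)) = 0 at h
      simpa [hpos, sub_eq_zero] using h

theorem continuous_stereographicEmbedding : Continuous stereographicEmbedding := by
  rw [OnePoint.continuous_iff]
  have hsq : Tendsto (fun z : ℂ => ‖z‖ ^ 2) (coclosedCompact ℂ) atTop := by
    rw [coclosedCompact_eq_cocompact]
    exact (tendsto_pow_atTop two_ne_zero).comp (tendsto_norm_cocompact_atTop (E := ℂ))
  have hnorm : Tendsto (fun z : ℂ => ‖z‖) (coclosedCompact ℂ) atTop := by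
    rw [coclosedCompact_eq_cocompact]
    exact tendsto_norm_cocompact_atTop
  have hpos : ∀ z : ℂ, (1 : ℝ) + ‖z‖ ^ 2 ≠ 0 := fun z => by positivity
  constructor
  · have h1 : Tendsto (fun z : ℂ => 2 / (1 + ‖z‖ ^ 2)) (coclosedCompact ℂ) (𝓝 0) :=
      (tendsto_atTop_add_const_left _ 1 hsq).const_div_atTop 2
    have h2 : Tendsto (fun z : ℂ => ((2 / (1 + ‖z‖ ^ 2) : ℝ) : ℂ) * z) (coclosedCompact ℂ)
        (𝓝 0) := by
      refine squeeze_zero_norm' (a := fun z : ℂ => 2 / ‖z‖) ?_ (hnorm.const_div_atTop 2)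
      filter_upwards [hnorm.eventually_gt_atTop 0] with z hz
      rw [norm_mul, Complex.norm_real, Real.norm_of_nonneg (by positivity), div_mul_eq_mul_div,
        div_le_div_iff₀ (by positivity) hz]
      nlinarith
    have h3 := h2.prodMk_nhds (h1.const_sub 1)
    rw [sub_zero] at h3
    exact ((WithLp.prod_continuous_toLp 2 ℂ ℝ).tendsto _).comp h3
  · refine (WithLp.prod_continuous_toLp 2 ℂ ℝ).comp (Continuous.prodMk ?_ ?_)
    · exact (Complex.continuous_ofReal.comp (by fun_prop (disch := exact hpos _))).mul
        continuous_id
    · fun_prop (disch := exact hpos _)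

/-- A continuous injection of a compact space into a Hausdorff space is an embedding; hence the
chordal metric induces the one-point compactification topology. -/
theorem isEmbedding_stereographicEmbedding : IsEmbedding stereographicEmbedding :=
  (continuous_stereographicEmbedding.isClosedEmbedding fun x y h =>
    eq_of_sphericalDist_eq_zero (by
      rw [← dist_stereographicEmbedding, h, dist_self])).isEmbedding

/-- The spherical metric makes the Riemann sphere a metric space, with its usual topology. -/
@[reducible] def sphereMetricSpace : MetricSpace (OnePoint ℂ) :=
  isEmbedding_stereographicEmbedding.comapMetricSpace _

attribute [local instance] sphereMetricSpace

theorem dist_eq_sphericalDist (x y : OnePoint ℂ) : dist x y = sphericalDist x y :=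
  dist_stereographicEmbedding x y

theorem convergesLocally_iff {F : ℕ → 𝔻 → OnePoint ℂ} {g : 𝔻 → OnePoint ℂ} :
    ConvergesLocally F g ↔ TendstoLocallyUniformly F g atTop := by
  have : LocallyCompactSpace 𝔻 :=
    (Metric.isOpen_ball (x := (0 : ℂ)) (ε := 1)).locallyCompactSpace
  rw [tendstoLocallyUniformly_iff_forall_isCompact]
  simp only [ConvergesLocally, Metric.tendstoUniformlyOn_iff, eventually_atTop,
    dist_comm (g _), dist_eq_sphericalDist]

/-! ### Functions that are holomorphic in the charts of the sphere -/

theorem isOpenEmbedding_coe : IsOpenEmbedding ((↑) : 𝔻 → ℂ) :=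
  Metric.isOpen_ball.isOpenEmbedding_subtypeVal

/-- The extension by zero of a function on the disc. -/
def discExtend (h : 𝔻 → ℂ) : ℂ → ℂ :=
  Function.extend (↑) h 0

@[simp]
theorem discExtend_coe (h : 𝔻 → ℂ) (z : 𝔻) : discExtend h z = h z :=
  Complex.UnitDisc.coe_injective.extend_apply _ _ _

theorem map_coe_nhdsNE (z : 𝔻) : map ((↑) : 𝔻 → ℂ) (𝓝[≠] z) = 𝓝[≠] (z : ℂ) := by
  rw [isOpenEmbedding_coe.map_nhdsWithin_eq]
  refine Eq.trans ?_ (nhdsWithin_inter_of_mem (s := Set.range ((↑) : 𝔻 → ℂ)) (t := {(z : ℂ)}ᶜ)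
    (nhdsWithin_le_nhds (isOpenEmbedding_coe.isOpen_range.mem_nhds ⟨z, rfl⟩)))
  congr 1
  ext w
  constructor
  · rintro ⟨x, hx, rfl⟩
    exact ⟨⟨x, rfl⟩, fun h => hx (Complex.UnitDisc.coe_injective h)⟩
  · rintro ⟨⟨x, rfl⟩, hx⟩
    exact ⟨x, fun h => hx (congrArg _ h), rfl⟩

theorem continuousAt_discExtend {h : 𝔻 → ℂ} {z : 𝔻} (hh : ContinuousAt h z) :
    ContinuousAt (discExtend h) z := by
  rw [ContinuousAt, ← isOpenEmbedding_coe.map_nhds_eq, tendsto_map'_iff]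
  simpa [Function.comp_def] using hh.tendsto

/-- The affine chart of the Riemann sphere (with junk value `0` at `∞`). -/
def affineChart (x : OnePoint ℂ) : ℂ :=
  x.elim 0 id

/-- The chart `z ↦ z⁻¹` of the Riemann sphere at `∞` (with junk value `0` at `0`). -/
def inverseChart (x : OnePoint ℂ) : ℂ :=
  x.elim 0 (·⁻¹)

theorem continuousOn_affineChart : ContinuousOn affineChart {∞}ᶜ := by
  refine continuousOn_of_forall_continuousAt fun x hx => ?_
  induction x using OnePoint.rec with
  | infty => exact absurd rfl hx
  | coe z => exact OnePoint.continuousAt_coe.2 continuousAt_id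

theorem injOn_affineChart : Set.InjOn affineChart {∞}ᶜ := by
  intro x hx y hy h
  induction x using OnePoint.rec with
  | infty => exact absurd rfl hx
  | coe z =>
    induction y using OnePoint.rec with
    | infty => exact absurd rfl hy
    | coe w => exact congrArg _ h

theorem continuousOn_inverseChart : ContinuousOn inverseChart {((0 : ℂ) : OnePoint ℂ)}ᶜ := by
  refine continuousOn_of_forall_continuousAt fun x hx => ?_
  induction x using OnePoint.rec with
  | infty =>
    refine OnePoint.continuousAt_infty'.2 ?_
    rw [coclosedCompact_eq_cocompact]
    exact tendsto_inv₀_cobounded.mono_left (Metric.cobounded_eq_cocompact (α := ℂ)).ge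
  | coe z =>
    have hz : z ≠ 0 := fun h => hx (congrArg _ h)
    exact OnePoint.continuousAt_coe.2 (continuousAt_inv₀ hz)

theorem injOn_inverseChart : Set.InjOn inverseChart {((0 : ℂ) : OnePoint ℂ)}ᶜ := by
  intro x hx y hy h
  induction x using OnePoint.rec with
  | infty =>
    induction y using OnePoint.rec with
    | infty => rfl
    | coe w => exact absurd (congrArg _ (inv_eq_zero.1 (Eq.symm h))) hy
  | coe z =>
    induction y using OnePoint.rec with
    | infty => exact absurd (congrArg _ (inv_eq_zero.1 h)) hx
    | coe w => exact congrArg _ (inv_injective h)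

/-- `f` is holomorphic in the chart `χ`, wherever its values lie in the domain `U` of `χ`. -/
def HolomorphicInChart (χ : OnePoint ℂ → ℂ) (U : Set (OnePoint ℂ)) (f : 𝔻 → OnePoint ℂ) : Prop :=
  ∀ z : 𝔻, f z ∈ U → AnalyticAt ℂ (discExtend (χ ∘ f)) z

/-- A meromorphic germ that is continuous at its centre has no pole and no wrong value there, so it
is analytic. -/
theorem holomorphicInChart_of_meromorphicAt {χ : OnePoint ℂ → ℂ} {U : Set (OnePoint ℂ)}
    {f : 𝔻 → OnePoint ℂ} (hχ : ContinuousOn χ U) (hU : IsOpen U) (hf : Continuous f)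
    (h : ∀ z : 𝔻, ∃ g : ℂ → ℂ, MeromorphicAt g z ∧ ∀ᶠ w : 𝔻 in 𝓝[≠] z, χ (f w) = g w) :
    HolomorphicInChart χ U f := by
  intro z hz
  obtain ⟨g, hg, hfg⟩ := h z
  refine MeromorphicAt.analyticAt (hg.congr ?_) (continuousAt_discExtend
    ((hχ.continuousAt (hU.mem_nhds hz)).comp hf.continuousAt))
  rw [EventuallyEq, ← map_coe_nhdsNE, eventually_map]
  filter_upwards [hfg] with w hw
  simp [hw]

theorem IsMeromorphic.holomorphicInChart_affineChart {f : 𝔻 → OnePoint ℂ} (hf : IsMeromorphic f) :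
    HolomorphicInChart affineChart {∞}ᶜ f :=
  holomorphicInChart_of_meromorphicAt continuousOn_affineChart
    OnePoint.isClosed_infty.isOpen_compl hf.1 fun z => by
      obtain ⟨g, hg, hfg⟩ := hf.2 z
      exact ⟨g, hg, hfg.mono fun w hw => by rw [hw]; rfl⟩

theorem IsMeromorphic.holomorphicInChart_inverseChart {f : 𝔻 → OnePoint ℂ} (hf : IsMeromorphic f) :
    HolomorphicInChart inverseChart {((0 : ℂ) : OnePoint ℂ)}ᶜ f :=
  holomorphicInChart_of_meromorphicAt continuousOn_inverseChart isClosed_singleton.isOpen_compl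
    hf.1 fun z => by
      obtain ⟨g, hg, hfg⟩ := hf.2 z
      -- The junk value of the chart at `0` agrees with `0⁻¹ = 0`, so zeros of `g` need no
      -- exception.
      exact ⟨g⁻¹, hg.inv, hfg.mono fun w hw => by rw [hw]; rfl⟩

/-- Local identity theorem for locally uniform limits of functions that are holomorphic in a
chart. -/
theorem eventually_eq_of_frequently_eq_of_chart {χ : OnePoint ℂ → ℂ} {U : Set (OnePoint ℂ)}
    (hU : IsOpen U) (hχ : ContinuousOn χ U) (hχinj : Set.InjOn χ U) {F : ℕ → 𝔻 → OnePoint ℂ}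
    {g : 𝔻 → OnePoint ℂ} (hF : ∀ n, HolomorphicInChart χ U (F n)) (hg : Continuous g)
    (hFg : TendstoLocallyUniformly F g atTop) {z : 𝔻} (hz : g z ∈ U)
    (h : ∃ᶠ w in 𝓝[≠] z, g w = g z) : ∀ᶠ w in 𝓝 z, g w = g z := by
  -- On a compact `K ⊆ U` the chart is uniformly continuous, so spherical convergence passes to the
  -- charts once `g` and almost all `F n` map a neighbourhood `V` of `z` into `K`.
  obtain ⟨K, hK, hzK, hKU⟩ := exists_compact_subset hU hz
  obtain ⟨ε, hε, hεK⟩ := Metric.isOpen_iff.1 isOpen_interior _ hzK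
  have hball : Metric.ball (g z) ε ⊆ K := hεK.trans interior_subset
  obtain ⟨t, ht, hFt⟩ := Metric.tendstoLocallyUniformly_iff.1 hFg (ε / 2) (half_pos hε) z
  set V : Set 𝔻 := interior t ∩ g ⁻¹' Metric.ball (g z) (ε / 2)
  have hVo : IsOpen V := isOpen_interior.inter (Metric.isOpen_ball.preimage hg)
  have hzV : z ∈ V := ⟨mem_interior_iff_mem_nhds.2 ht, Metric.mem_ball_self (half_pos hε)⟩
  have hgK : ∀ w ∈ V, g w ∈ K := fun w hw =>
    hball (Metric.ball_subset_ball (half_le_self hε.le) hw.2)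
  have hFK : ∀ᶠ n in atTop, ∀ w ∈ V, F n w ∈ K := by
    filter_upwards [hFt] with n hn w hw
    refine hball (Metric.mem_ball.2 ?_)
    have h1 := hn w (interior_subset hw.1)
    have h2 := Metric.mem_ball.1 hw.2
    have h3 := dist_triangle_left (F n w) (g z) (g w)
    linarith
  have hunif := Metric.uniformContinuousOn_iff.1
    (hK.uniformContinuousOn_of_continuous (hχ.mono hKU))
  have hlim : TendstoLocallyUniformlyOn (fun n => discExtend (χ ∘ F n)) (discExtend (χ ∘ g)) atTop
      ((↑) '' V) := by
    rw [Metric.tendstoLocallyUniformlyOn_iff]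
    rintro δ hδ _ ⟨w, hw, rfl⟩
    obtain ⟨η, hη, hχη⟩ := hunif δ hδ
    obtain ⟨s, hs, hFs⟩ := Metric.tendstoLocallyUniformly_iff.1 hFg η hη w
    refine ⟨(↑) '' (s ∩ V), mem_nhdsWithin_of_mem_nhds
      (isOpenEmbedding_coe.image_mem_nhds.2 (inter_mem hs (hVo.mem_nhds hw))), ?_⟩
    filter_upwards [hFs, hFK] with n hn hnK
    rintro _ ⟨x, hx, rfl⟩
    simpa using hχη _ (hgK x hx.2) _ (hnK x hx.2) (hn x hx.1)
  have hVo' : IsOpen (((↑) : 𝔻 → ℂ) '' V) := isOpenEmbedding_coe.isOpenMap _ hVo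
  have hdiff : DifferentiableOn ℂ (discExtend (χ ∘ g)) ((↑) '' V) := by
    refine hlim.differentiableOn ?_ hVo'
    filter_upwards [hFK] with n hn
    rintro _ ⟨w, hw, rfl⟩
    exact (hF n w (hKU (hn w hw))).differentiableAt.differentiableWithinAt
  have han : AnalyticAt ℂ (discExtend (χ ∘ g)) z :=
    hdiff.analyticAt (hVo'.mem_nhds ⟨z, hzV, rfl⟩)
  have hfreq : ∃ᶠ w in 𝓝[≠] (z : ℂ), discExtend (χ ∘ g) w = χ (g z) := by
    rw [← map_coe_nhdsNE, frequently_map]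
    exact h.mono fun w hw => by simp [hw]
  have hev : ∀ᶠ w in 𝓝 (z : ℂ), discExtend (χ ∘ g) w = χ (g z) :=
    (han.frequently_eq_iff_eventually_eq analyticAt_const).1 hfreq
  rw [← isOpenEmbedding_coe.map_nhds_eq, eventually_map] at hev
  filter_upwards [hev, hVo.mem_nhds hzV] with w hw hwV
  exact hχinj (hKU (hgK w hwV)) hz (by simpa using hw)

/-- Identity theorem for locally uniform limits of meromorphic functions. -/
theorem eq_of_frequently_eq {F : ℕ → 𝔻 → OnePoint ℂ} {g : 𝔻 → OnePoint ℂ} {c : OnePoint ℂ}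
    (hFa : ∀ n, HolomorphicInChart affineChart {∞}ᶜ (F n))
    (hFi : ∀ n, HolomorphicInChart inverseChart {((0 : ℂ) : OnePoint ℂ)}ᶜ (F n))
    (hg : Continuous g) (hFg : TendstoLocallyUniformly F g atTop) {z₀ : 𝔻}
    (h : ∃ᶠ w in 𝓝[≠] z₀, g w = c) (z : 𝔻) : g z = c := by
  -- The accumulation points of `g⁻¹{c}` form an open set by the local identity theorem, and a
  -- closed one; the disc is connected.
  set A : Set 𝔻 := {z | ∃ᶠ w in 𝓝[≠] z, g w = c}
  have hval : ∀ x ∈ A, g x = c := fun x hx =>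
    IsClosed.mem_of_frequently_of_tendsto (f := id) (s := g ⁻¹' {c})
      (isClosed_singleton.preimage hg) hx
      (tendsto_id.mono_left nhdsWithin_le_nhds)
  have hloc : ∀ x ∈ A, ∀ᶠ w in 𝓝 x, g w = c := by
    intro x hx
    have hgx := hval x hx
    have hfreq : ∃ᶠ w in 𝓝[≠] x, g w = g x := by rwa [hgx]
    rw [← hgx]
    by_cases hinf : g x = ∞
    · refine eventually_eq_of_frequently_eq_of_chart isClosed_singleton.isOpen_compl
        continuousOn_inverseChart injOn_inverseChart hFi hg hFg ?_ hfreq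
      rw [hinf]
      exact OnePoint.infty_ne_coe 0
    · exact eventually_eq_of_frequently_eq_of_chart OnePoint.isClosed_infty.isOpen_compl
        continuousOn_affineChart injOn_affineChart hFa hg hFg hinf hfreq
  have hne : ∀ x : 𝔻, (𝓝[≠] x).NeBot := fun x => by
    rw [← map_neBot_iff ((↑) : 𝔻 → ℂ), map_coe_nhdsNE]
    infer_instance
  have hopen : IsOpen A := isOpen_iff_mem_nhds.2 fun x hx => by
    filter_upwards [eventually_eventually_nhds.2 (hloc x hx)] with y hy
    have := hne y
    exact (hy.filter_mono nhdsWithin_le_nhds).frequently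
  have : T2Space 𝔻 := isOpenEmbedding_coe.isEmbedding.t2Space
  have hclosed : IsClosed A := by
    rw [← isOpen_compl_iff, isOpen_iff_mem_nhds]
    intro x hx
    have hx' : ∀ᶠ w in 𝓝[≠] x, g w ≠ c := not_frequently.1 hx
    filter_upwards [eventually_nhdsWithin_iff.1 (eventually_eventually_nhdsWithin.2 hx')]
      with y hy hyA
    by_cases hyx : y = x
    · exact hx (hyx ▸ hyA)
    · have hyx' := hy hyx
      rw [(isOpen_compl_singleton.nhdsWithin_eq (show y ∈ ({x}ᶜ : Set 𝔻) from hyx))] at hyx'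
      exact hyx'.self_of_nhds (hval y hyA)
  have : PreconnectedSpace 𝔻 := Subtype.preconnectedSpace
    (convex_ball (0 : ℂ) 1).isPreconnected
  exact hval z ((IsClopen.eq_univ ⟨hclosed, hopen⟩ ⟨z₀, h⟩).symm ▸ Set.mem_univ z)

/-! ### Automorphisms of the disc and the pseudo-hyperbolic distance -/

theorem coe_mobius (w z : 𝔻) :
    (mobius w z : ℂ) = ((z : ℂ) + w) / (1 + (z : ℂ) * (starRingEnd ℂ) (w : ℂ)) :=
  rfl

theorem one_add_mul_conj_ne_zero {z w : ℂ} (hz : ‖z‖ < 1) (hw : ‖w‖ < 1) :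
    1 + z * (starRingEnd ℂ) w ≠ 0 := by
  intro h
  have h1 : ‖z * (starRingEnd ℂ) w‖ = 1 := by
    rw [eq_neg_of_add_eq_zero_right h, norm_neg, norm_one]
  rw [norm_mul, RCLike.norm_conj] at h1
  nlinarith [norm_nonneg z, norm_nonneg w]

theorem one_sub_mul_conj_ne_zero {z w : ℂ} (hz : ‖z‖ < 1) (hw : ‖w‖ < 1) :
    1 - z * (starRingEnd ℂ) w ≠ 0 := by
  simpa [sub_eq_add_neg] using one_add_mul_conj_ne_zero hz (w := -w) (by simpa using hw)

theorem continuous_mobius : Continuous fun p : 𝔻 × 𝔻 => mobius p.1 p.2 := by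
  refine isOpenEmbedding_coe.isEmbedding.continuous_iff.2 ?_
  have hcoe := Complex.UnitDisc.continuous_coe
  refine Continuous.div ?_ ?_ fun p => one_add_mul_conj_ne_zero p.2.norm_lt_one p.1.norm_lt_one
  · exact (hcoe.comp continuous_snd).add (hcoe.comp continuous_fst)
  · exact continuous_const.add ((hcoe.comp continuous_snd).mul
      (Complex.continuous_conj.comp (hcoe.comp continuous_fst)))

theorem pseudoHyperbolicDist_comm (z w : 𝔻) :
    pseudoHyperbolicDist z w = pseudoHyperbolicDist w z := by
  have h : (1 - (w : ℂ) * (starRingEnd ℂ) (z : ℂ)) =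
      (starRingEnd ℂ) (1 - (z : ℂ) * (starRingEnd ℂ) (w : ℂ)) := by
    simp [mul_comm]
  rw [pseudoHyperbolicDist, pseudoHyperbolicDist, norm_div, norm_div, h, RCLike.norm_conj,
    norm_sub_rev]

theorem continuous_pseudoHyperbolicDist_left (w : 𝔻) :
    Continuous fun z => pseudoHyperbolicDist z w := by
  have hcoe := Complex.UnitDisc.continuous_coe
  exact ((hcoe.sub continuous_const).div (continuous_const.sub (hcoe.mul continuous_const))
    fun z => one_sub_mul_conj_ne_zero z.norm_lt_one w.norm_lt_one).norm

theorem pseudoHyperbolicDist_mobius (w z : 𝔻) :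
    pseudoHyperbolicDist (mobius w z) w = ‖(z : ℂ)‖ := by
  have h1 := one_add_mul_conj_ne_zero z.norm_lt_one w.norm_lt_one
  have h2 := one_sub_mul_conj_ne_zero w.norm_lt_one w.norm_lt_one
  have h3 := one_sub_mul_conj_ne_zero (mobius w z).norm_lt_one w.norm_lt_one
  rw [pseudoHyperbolicDist]
  congr 1
  rw [div_eq_iff h3, coe_mobius]
  field_simp
  ring

theorem exists_mobius_eq (w z : 𝔻) :
    ∃ ζ : 𝔻, mobius w ζ = z ∧ ‖(ζ : ℂ)‖ = pseudoHyperbolicDist z w := by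
  have hinv : mobius w (mobius (-w) z) = z := by
    have h1 := one_add_mul_conj_ne_zero (mobius (-w) z).norm_lt_one w.norm_lt_one
    have h2 := one_sub_mul_conj_ne_zero z.norm_lt_one w.norm_lt_one
    have h3 : 1 + (z : ℂ) * (starRingEnd ℂ) (-(w : ℂ)) ≠ 0 := by
      simpa [sub_eq_add_neg] using h2
    refine Complex.UnitDisc.coe_injective ?_
    rw [coe_mobius, div_eq_iff h1, coe_mobius, Complex.UnitDisc.coe_neg]
    field_simp
    simp only [map_neg]
    ring
  exact ⟨_, hinv, by rw [← pseudoHyperbolicDist_mobius w, hinv]⟩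

/-- This rests on `φ_w(ζ) - w = ζ(1 - |w|²)/(1 + ζ w̄)`: discs of fixed pseudo-hyperbolic radius
collapse as `w` nears the unit circle. -/
theorem norm_mobius_sub_le {r : ℝ} (hr : r < 1) (w : 𝔻) {ζ : 𝔻} (hζ : ‖(ζ : ℂ)‖ ≤ r) :
    ‖(mobius w ζ : ℂ) - w‖ ≤ (1 - ‖(w : ℂ)‖ ^ 2) / (1 - r) := by
  have hw := w.norm_lt_one
  have hne := one_add_mul_conj_ne_zero ζ.norm_lt_one hw
  have hr0 : 0 ≤ r := (norm_nonneg _).trans hζ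
  have hfac : (mobius w ζ : ℂ) - w =
      ζ * ((1 - ‖(w : ℂ)‖ ^ 2 : ℝ) : ℂ) / (1 + (ζ : ℂ) * (starRingEnd ℂ) (w : ℂ)) := by
    rw [coe_mobius, eq_div_iff hne, sub_mul, div_mul_cancel₀ _ hne, Complex.ofReal_sub,
      ← Complex.normSq_eq_norm_sq, Complex.normSq_eq_conj_mul_self, Complex.ofReal_one]
    ring
  have hden : 1 - r ≤ ‖1 + (ζ : ℂ) * (starRingEnd ℂ) (w : ℂ)‖ := by
    have h1 := norm_sub_norm_le (1 : ℂ) (-((ζ : ℂ) * (starRingEnd ℂ) (w : ℂ)))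
    rw [norm_neg, norm_mul, RCLike.norm_conj, norm_one, sub_neg_eq_add] at h1
    nlinarith [norm_nonneg (ζ : ℂ), norm_nonneg (w : ℂ)]
  have hnum : 0 ≤ 1 - ‖(w : ℂ)‖ ^ 2 := by nlinarith [norm_nonneg (w : ℂ)]
  rw [hfac, norm_div, norm_mul, Complex.norm_real, Real.norm_of_nonneg hnum]
  refine div_le_div₀ hnum ?_ (sub_pos.2 hr) hden
  exact mul_le_of_le_one_left hnum (hζ.trans hr.le)

theorem tendsto_of_pseudoHyperbolicDist_le {ι : Type*} {l : Filter ι} {z w : ι → 𝔻} {ξ : ℂ}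
    (hξ : ‖ξ‖ = 1) {r : ℝ} (hr : r < 1) (hzw : ∀ i, pseudoHyperbolicDist (z i) (w i) ≤ r)
    (hw : Tendsto (fun i => (w i : ℂ)) l (𝓝 ξ)) : Tendsto (fun i => (z i : ℂ)) l (𝓝 ξ) := by
  have hlim : Tendsto (fun i => (1 - ‖(w i : ℂ)‖ ^ 2) / (1 - r)) l (𝓝 0) := by
    simpa [hξ] using ((hw.norm.pow 2).const_sub 1).div_const (1 - r)
  have hdiff : Tendsto (fun i => (z i : ℂ) - w i) l (𝓝 0) :=
    squeeze_zero_norm (fun i => by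
      obtain ⟨ζ, hζ, hζn⟩ := exists_mobius_eq (w i) (z i)
      rw [← hζ]
      exact norm_mobius_sub_le hr _ (hζn.trans_le (hzw i))) hlim
  simpa using hdiff.add hw

theorem HolomorphicInChart.comp_mobius {χ : OnePoint ℂ → ℂ} {U : Set (OnePoint ℂ)}
    {f : 𝔻 → OnePoint ℂ} (hf : HolomorphicInChart χ U f) (w : 𝔻) :
    HolomorphicInChart χ U (f ∘ mobius w) := by
  intro z hz
  have hm : AnalyticAt ℂ (fun ζ : ℂ => (ζ + w) / (1 + ζ * (starRingEnd ℂ) (w : ℂ))) z :=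
    (analyticAt_id.add analyticAt_const).div
      (analyticAt_const.add (analyticAt_id.mul analyticAt_const))
      (one_add_mul_conj_ne_zero z.norm_lt_one w.norm_lt_one)
  have hcomp := AnalyticAt.fun_comp (x := (z : ℂ)) (hf (mobius w z) hz) hm
  refine hcomp.congr ?_
  filter_upwards [isOpenEmbedding_coe.isOpen_range.mem_nhds ⟨z, rfl⟩]
  rintro _ ⟨x, rfl⟩
  rw [← coe_mobius, discExtend_coe, discExtend_coe]
  rfl

/-! ### Curves in the disc and boundary values along them -/

theorem exists_subseq_tendsto_unitDisc {r : ℝ} (hr : r < 1) {z : ℕ → 𝔻}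
    (hz : ∀ n, ‖(z n : ℂ)‖ ≤ r) :
    ∃ ζ : 𝔻, ∃ k : ℕ → ℕ, StrictMono k ∧ Tendsto (z ∘ k) atTop (𝓝 ζ) := by
  obtain ⟨a, ha, k, hk, hlim⟩ := (isCompact_closedBall (0 : ℂ) r).tendsto_subseq
    (x := fun n => (z n : ℂ)) fun n => mem_closedBall_zero_iff.2 (hz n)
  lift a to 𝔻 using (mem_closedBall_zero_iff.1 ha).trans_lt hr
  exact ⟨a, k, hk, isOpenEmbedding_coe.isEmbedding.tendsto_nhds_iff.2 hlim⟩

theorem tendstoLocallyUniformly_comp_index {X Y ι κ : Type*} [TopologicalSpace X]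
    [UniformSpace Y] {F : ι → X → Y} {g : X → Y} {l : Filter ι} {l' : Filter κ}
    (h : TendstoLocallyUniformly F g l) {k : κ → ι} (hk : Tendsto k l' l) :
    TendstoLocallyUniformly (fun i => F (k i)) g l' := fun u hu x => by
  obtain ⟨t, ht, h⟩ := h u hu x
  exact ⟨t, ht, hk.eventually h⟩

theorem mem_curvilinearAngle {γ : Set 𝔻} {r : ℝ} {z : 𝔻} :
    z ∈ curvilinearAngle γ r ↔ ∃ w ∈ γ, pseudoHyperbolicDist z w ≤ r := by
  simp [curvilinearAngle]

theorem subset_curvilinearAngle {γ : Set 𝔻} {r : ℝ} (hr : 0 ≤ r) : γ ⊆ curvilinearAngle γ r :=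
  fun w hw => mem_curvilinearAngle.2 ⟨w, hw, by simpa [pseudoHyperbolicDist] using hr⟩

theorem HasAsymptoticValue.tendsto_comp {f : 𝔻 → OnePoint ℂ} {γ : Set 𝔻} {ξ : ℂ} {c : OnePoint ℂ}
    (h : HasAsymptoticValue f γ ξ c) {ι : Type*} {l : Filter ι} {z : ι → 𝔻} (hz : ∀ i, z i ∈ γ)
    (hlim : Tendsto (fun i => (z i : ℂ)) l (𝓝 ξ)) : Tendsto (fun i => f (z i)) l (𝓝 c) :=
  h.comp (tendsto_inf.2 ⟨tendsto_comap_iff.2 hlim, tendsto_principal.2 (.of_forall hz)⟩)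

theorem IsSimpleCurveEndingAt.exists_seq_tendsto {γ : Set 𝔻} {ξ : ℂ}
    (hγ : IsSimpleCurveEndingAt γ ξ) :
    ∃ z : ℕ → 𝔻, (∀ n, z n ∈ γ) ∧ Tendsto (fun n => (z n : ℂ)) atTop (𝓝 ξ) := by
  obtain ⟨p, -, -, rfl, hlim⟩ := hγ
  have hpos : ∀ n : ℕ, (0 : ℝ) < 1 / ((n : ℝ) + 1) := fun n => by positivity
  have hle : ∀ n : ℕ, (1 : ℝ) / ((n : ℝ) + 1) ≤ 1 := fun n => by
    rw [div_le_one (by positivity)]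
    linarith [n.cast_nonneg (α := ℝ)]
  refine ⟨fun n => p (1 - 1 / ((n : ℝ) + 1)), fun n => ⟨_, ⟨?_, ?_⟩, rfl⟩, hlim.comp ?_⟩
  · linarith [hle n]
  · linarith [hpos n]
  · refine tendsto_nhdsWithin_iff.2 ⟨?_, .of_forall fun n => ?_⟩
    · simpa using tendsto_one_div_add_atTop_nhds_zero_nat.const_sub (1 : ℝ)
    · exact Set.mem_Iio.2 (by linarith [hpos n])

/-- A curve that ends at a boundary point meets every pseudo-hyperbolic circle centred on it. -/
theorem IsSimpleCurveEndingAt.exists_mobius_mem {γ : Set 𝔻} {ξ : ℂ}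
    (hγ : IsSimpleCurveEndingAt γ ξ) (hξ : ‖ξ‖ = 1) {w : 𝔻} (hw : w ∈ γ) {ρ : ℝ}
    (hρ : ρ ∈ Set.Ioo (0 : ℝ) 1) : ∃ ζ : 𝔻, mobius w ζ ∈ γ ∧ ‖(ζ : ℂ)‖ = ρ := by
  obtain ⟨p, hp, -, rfl, hlim⟩ := hγ
  obtain ⟨s, hs, rfl⟩ := hw
  set w := p s
  have hne : ξ - w ≠ 0 := fun h => by
    have := w.norm_lt_one
    rw [← sub_eq_zero.1 h, hξ] at this
    exact lt_irrefl _ this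
  -- On the unit circle `ξ ξ̄ = 1`, so numerator and denominator of the distance to `w` have equal
  -- modulus in the limit: the distance tends to `1`.
  have hnorm : ‖1 - ξ * (starRingEnd ℂ) (w : ℂ)‖ = ‖ξ - w‖ := by
    have h1 : ξ * (starRingEnd ℂ) ξ = 1 := by
      rw [Complex.mul_conj, Complex.normSq_eq_norm_sq, hξ]
      simp
    rw [← h1, ← mul_sub, ← map_sub, norm_mul, RCLike.norm_conj, hξ, one_mul]
  have hden : 1 - ξ * (starRingEnd ℂ) (w : ℂ) ≠ 0 := by
    rwa [← norm_ne_zero_iff, hnorm, norm_ne_zero_iff]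
  have hto : Tendsto (fun t => pseudoHyperbolicDist (p t) w) (𝓝[<] 1) (𝓝 1) := by
    have h := ((hlim.sub_const (w : ℂ)).div
      ((hlim.mul_const ((starRingEnd ℂ) (w : ℂ))).const_sub 1) hden).norm
    rwa [norm_div, hnorm, div_self (norm_ne_zero_iff.2 hne)] at h
  obtain ⟨t, hρt, hst, ht1⟩ := ((hto.eventually_const_lt hρ.2).and
    (Ioo_mem_nhdsLT hs.2)).exists
  have hsub : Set.Icc s t ⊆ Set.Ico 0 1 := fun x hx => ⟨hs.1.trans hx.1, hx.2.trans_lt ht1⟩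
  have hcont : ContinuousOn (fun t => pseudoHyperbolicDist (p t) w) (Set.Icc s t) :=
    (continuous_pseudoHyperbolicDist_left w).comp_continuousOn (hp.mono hsub)
  have h0 : pseudoHyperbolicDist (p s) w = 0 := by simp [pseudoHyperbolicDist, w]
  obtain ⟨x, hx, hxρ⟩ := intermediate_value_Icc hst.le hcont
    ⟨h0.trans_le hρ.1.le, hρt.le⟩
  obtain ⟨ζ, hζ, hζn⟩ := exists_mobius_eq w (p x)
  exact ⟨ζ, hζ ▸ ⟨x, hsub hx, rfl⟩, hζn.trans hxρ⟩

/-- If `f` has the asymptotic value `c` along `γ`, then every locally uniform limit of functions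
`f ∘ φ_w` with `w ∈ γ` tending to the endpoint is identically `c`. -/
theorem eq_of_tendstoLocallyUniformly_comp_mobius {f : 𝔻 → OnePoint ℂ} (hf : IsMeromorphic f)
    {γ : Set 𝔻} {ξ : ℂ} (hξ : ‖ξ‖ = 1) (hγ : IsSimpleCurveEndingAt γ ξ) {c : OnePoint ℂ}
    (hc : HasAsymptoticValue f γ ξ c) {w : ℕ → 𝔻} (hw : ∀ n, w n ∈ γ)
    (hwlim : Tendsto (fun n => (w n : ℂ)) atTop (𝓝 ξ)) {g : 𝔻 → OnePoint ℂ}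
    (hg : Continuous g) (hlim : TendstoLocallyUniformly (fun n => f ∘ mobius (w n)) g atTop)
    (z : 𝔻) : g z = c := by
  have hcircle : ∀ ρ ∈ Set.Ioo (0 : ℝ) 1, ∃ ζ : 𝔻, ‖(ζ : ℂ)‖ = ρ ∧ g ζ = c := by
    intro ρ hρ
    choose ζ hζγ hζ using fun n => hγ.exists_mobius_mem hξ (hw n) hρ
    obtain ⟨η, k, hk, hη⟩ := exists_subseq_tendsto_unitDisc hρ.2 fun n => (hζ n).le
    have hξlim : Tendsto (fun n => (mobius (w n) (ζ n) : ℂ)) atTop (𝓝 ξ) :=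
      tendsto_of_pseudoHyperbolicDist_le hξ hρ.2
        (fun n => ((pseudoHyperbolicDist_mobius _ _).trans (hζ n)).le) hwlim
    refine ⟨η, ?_, tendsto_nhds_unique ?_
      ((hc.tendsto_comp hζγ hξlim).comp hk.tendsto_atTop)⟩
    · refine tendsto_nhds_unique ((Complex.UnitDisc.continuous_coe.tendsto η).comp hη).norm ?_
      simp [hζ]
    · exact (tendstoLocallyUniformly_comp_index hlim hk.tendsto_atTop).tendsto_comp
        hg.continuousAt hη
  -- Positive radii tending to `0` make the centre an accumulation point of `g⁻¹{c}`; the shift by 2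
  -- keeps the first radius below `1`.
  have hρ : ∀ n : ℕ, (1 : ℝ) / (n + 2) ∈ Set.Ioo (0 : ℝ) 1 := fun n =>
    ⟨by positivity, by
      rw [div_lt_one (by positivity)]
      linarith [n.cast_nonneg (α := ℝ)]⟩
  choose ζ hζ hζc using fun n => hcircle _ (hρ n)
  have hζlim : Tendsto ζ atTop (𝓝[≠] 0) := by
    refine tendsto_nhdsWithin_iff.2 ⟨isOpenEmbedding_coe.isEmbedding.tendsto_nhds_iff.2 ?_,
      .of_forall fun n h => ?_⟩
    · rw [Complex.UnitDisc.coe_zero, tendsto_zero_iff_norm_tendsto_zero]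
      simp only [Function.comp_apply, hζ]
      have h := (tendsto_const_div_atTop_nhds_zero_nat (1 : ℝ)).comp (tendsto_add_atTop_nat 2)
      simpa [Function.comp_def] using h
    · have h0 := (hρ n).1
      rw [← hζ n, Set.mem_singleton_iff.1 h] at h0
      simp at h0
  exact eq_of_frequently_eq (fun n => hf.holomorphicInChart_affineChart.comp_mobius (w n))
    (fun n => hf.holomorphicInChart_inverseChart.comp_mobius (w n)) hg hlim
    (hζlim.frequently (Eventually.of_forall hζc).frequently) z

/-! ### Boundary values from normality -/

theorem isDeltaBoundaryValue_of_isNormalAlong {f : 𝔻 → OnePoint ℂ} (hf : IsMeromorphic f)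
    {γ : Set 𝔻} {ξ : ℂ} (hξ : ‖ξ‖ = 1) (hγ : IsSimpleCurveEndingAt γ ξ) {c : OnePoint ℂ}
    (hnormal : IsNormalAlong f γ) (hc : HasAsymptoticValue f γ ξ c) :
    IsDeltaBoundaryValue f γ ξ c := by
  intro r hr
  refine Set.Subset.antisymm ?_ (Set.singleton_subset_iff.2 ?_)
  · rintro a ⟨z, hz, hzξ, hza⟩
    choose w hwγ hzw using fun n => mem_curvilinearAngle.1 (hz n)
    have hwξ : Tendsto (fun n => (w n : ℂ)) atTop (𝓝 ξ) :=
      tendsto_of_pseudoHyperbolicDist_le hξ hr.2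
        (fun n => (pseudoHyperbolicDist_comm _ _).trans_le (hzw n)) hzξ
    choose ζ hζ hζn using fun n => exists_mobius_eq (w n) (z n)
    obtain ⟨k, hk, g, hFg⟩ := hnormal (fun n => f ∘ mobius (w n))
      fun n => ⟨w n, hwγ n, rfl⟩
    rw [convergesLocally_iff] at hFg
    have hcont : ∀ v : 𝔻, Continuous (f ∘ mobius v) := fun v =>
      hf.1.comp (continuous_mobius.comp (Continuous.prodMk_right v))
    -- Normality allows an arbitrary limit function; continuity comes from the locally uniform
    -- convergence.
    have hg : Continuous g := hFg.continuous (.of_forall fun n => hcont _)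
    have hgc := eq_of_tendstoLocallyUniformly_comp_mobius hf hξ hγ hc (fun n => hwγ (k n))
      (hwξ.comp hk.tendsto_atTop) hg hFg
    obtain ⟨η, m, hm, hη⟩ := exists_subseq_tendsto_unitDisc hr.2
      (z := fun n => ζ (k n)) fun n => (hζn (k n)).trans_le (hzw (k n))
    have h1 := (tendstoLocallyUniformly_comp_index hFg hm.tendsto_atTop).tendsto_comp
      hg.continuousAt hη
    have h2 := hza.comp ((hk.comp hm).tendsto_atTop)
    refine tendsto_nhds_unique h2 ?_
    simpa [Function.comp_def, hζ, hgc] using h1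
  · obtain ⟨z, hzγ, hz⟩ := hγ.exists_seq_tendsto
    exact ⟨z, fun n => subset_curvilinearAngle hr.1.le (hzγ n), hz, hc.tendsto_comp hzγ hz⟩

/-! ### Normality and limits from boundary values -/

theorem IsDeltaBoundaryValue.hasAsymptoticValue_curvilinearAngle {f : 𝔻 → OnePoint ℂ}
    {γ : Set 𝔻} {ξ : ℂ} {c : OnePoint ℂ} (h : IsDeltaBoundaryValue f γ ξ c) {r : ℝ}
    (hr : r ∈ Set.Ioo (0 : ℝ) 1) : HasAsymptoticValue f (curvilinearAngle γ r) ξ c := by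
  refine tendsto_of_subseq_tendsto fun x hx => ?_
  obtain ⟨hxξ, hxΔ⟩ := tendsto_inf.1 hx
  obtain ⟨N, hN⟩ := eventually_atTop.1 (tendsto_principal.1 hxΔ)
  -- The sphere is compact, so the values subconverge, and the limit is a cluster value, hence `c`.
  -- The shift by `N` is needed because `x` lies in the angle only eventually.
  obtain ⟨a, -, k, hk, ha⟩ := isCompact_univ.tendsto_subseq (x := fun n => f (x (n + N)))
    fun _ => Set.mem_univ _
  have hshift : Tendsto (fun n => k n + N) atTop atTop :=
    (tendsto_add_atTop_nat N).comp hk.tendsto_atTop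
  have hac : a ∈ clusterSet f (curvilinearAngle γ r) ξ :=
    ⟨fun n => x (k n + N), fun n => hN _ (Nat.le_add_left _ _),
      (tendsto_comap_iff.1 hxξ).comp hshift, ha⟩
  rw [h r hr] at hac
  rw [Set.mem_singleton_iff.1 hac] at ha
  exact ⟨_, ha⟩

theorem IsDeltaBoundaryValue.hasAsymptoticValue {f : 𝔻 → OnePoint ℂ}
    {γ : Set 𝔻} {ξ : ℂ} {c : OnePoint ℂ} (h : IsDeltaBoundaryValue f γ ξ c) :
    HasAsymptoticValue f γ ξ c :=
  (h.hasAsymptoticValue_curvilinearAngle (r := 1 / 2) ⟨by norm_num, by norm_num⟩).mono_left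
    (inf_le_inf_left _ (principal_mono.2 (subset_curvilinearAngle (by norm_num))))

/-- Sequences on a curve in the disc accumulate in the disc or at the endpoint of the curve. -/
theorem IsSimpleCurveEndingAt.exists_subseq_tendsto {γ : Set 𝔻} {ξ : ℂ}
    (hγ : IsSimpleCurveEndingAt γ ξ) {w : ℕ → 𝔻} (hw : ∀ n, w n ∈ γ) :
    ∃ k : ℕ → ℕ, StrictMono k ∧ (Tendsto (fun n => (w (k n) : ℂ)) atTop (𝓝 ξ) ∨
      ∃ v : 𝔻, Tendsto (fun n => w (k n)) atTop (𝓝 v)) := by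
  obtain ⟨p, hp, -, rfl, hlim⟩ := hγ
  choose t ht htw using hw
  obtain ⟨s, hs, k, hk, hks⟩ := (isCompact_Icc (a := (0 : ℝ)) (b := 1)).tendsto_subseq
    fun n => Set.Ico_subset_Icc_self (ht n)
  refine ⟨k, hk, ?_⟩
  simp only [← htw]
  -- The limit parameter decides: `s = 1` gives the endpoint, `s < 1` the point `p s` of the curve.
  rcases hs.2.eq_or_lt with rfl | hs1
  · exact .inl (hlim.comp (tendsto_nhdsWithin_iff.2 ⟨hks, .of_forall fun n => (ht (k n)).2⟩))
  · exact .inr ⟨p s, (hp s ⟨hs.1, hs1⟩).tendsto.comp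
      (tendsto_nhdsWithin_iff.2 ⟨hks, .of_forall fun n => ht (k n)⟩)⟩

/-- Currying the jointly continuous `(v, ζ) ↦ f (φ_v ζ)` makes `v ↦ f ∘ φ_v` continuous for the
compact-open topology, which is that of locally uniform convergence. -/
theorem tendstoLocallyUniformly_comp_mobius {f : 𝔻 → OnePoint ℂ} (hf : Continuous f)
    {w : ℕ → 𝔻} {v : 𝔻} (hw : Tendsto w atTop (𝓝 v)) :
    TendstoLocallyUniformly (fun n => f ∘ mobius (w n)) (f ∘ mobius v) atTop := by
  have : LocallyCompactSpace 𝔻 :=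
    (Metric.isOpen_ball (x := (0 : ℂ)) (ε := 1)).locallyCompactSpace
  let φ : C(𝔻 × 𝔻, OnePoint ℂ) := ⟨fun p => f (mobius p.1 p.2), hf.comp continuous_mobius⟩
  exact ContinuousMap.tendsto_iff_tendstoLocallyUniformly.1
    ((φ.curry.continuous.tendsto v).comp hw)

theorem IsDeltaBoundaryValue.convergesLocally {f : 𝔻 → OnePoint ℂ} {γ : Set 𝔻} {ξ : ℂ}
    (hξ : ‖ξ‖ = 1) {c : OnePoint ℂ} (h : IsDeltaBoundaryValue f γ ξ c) {w : ℕ → 𝔻}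
    (hw : ∀ n, w n ∈ γ) (hwlim : Tendsto (fun n => (w n : ℂ)) atTop (𝓝 ξ)) :
    ConvergesLocally (fun n => f ∘ mobius (w n)) fun _ => c := by
  intro K hK ε hε
  obtain ⟨r, hr, hKr⟩ : ∃ r ∈ Set.Ioo (0 : ℝ) 1, ∀ z ∈ K, ‖(z : ℂ)‖ ≤ r := by
    rcases K.eq_empty_or_nonempty with rfl | hne
    · exact ⟨1 / 2, ⟨by norm_num, by norm_num⟩, by simp⟩
    · obtain ⟨x, -, hx⟩ := hK.exists_isMaxOn hne Complex.UnitDisc.continuous_coe.norm.continuousOn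
      refine ⟨max ‖(x : ℂ)‖ (1 / 2), ⟨by positivity, max_lt x.norm_lt_one (by norm_num)⟩,
        fun z hz => le_max_of_le_left (hx hz)⟩
  have hlim := h.hasAsymptoticValue_curvilinearAngle hr
  -- Failure of uniformity yields points of one angle `Δ_r γ` tending to `ξ` whose images stay `ε`
  -- away from `c`.
  by_contra! hbad
  choose n hn z hzK hz using hbad
  have hnlim : Tendsto n atTop atTop := tendsto_atTop_mono hn tendsto_id
  have hd : ∀ N, pseudoHyperbolicDist (mobius (w (n N)) (z N)) (w (n N)) ≤ r := fun N =>
    (pseudoHyperbolicDist_mobius _ _).trans_le (hKr _ (hzK N))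
  have hto : Tendsto (fun N => f (mobius (w (n N)) (z N))) atTop (𝓝 c) :=
    hlim.tendsto_comp (fun N => mem_curvilinearAngle.2 ⟨_, hw (n N), hd N⟩)
      (tendsto_of_pseudoHyperbolicDist_le hξ hr.2 hd (hwlim.comp hnlim))
  obtain ⟨N, hN⟩ := (Metric.tendsto_nhds.1 hto ε hε).exists
  rw [dist_eq_sphericalDist] at hN
  exact (hz N).not_gt hN

theorem IsDeltaBoundaryValue.isNormalAlong {f : 𝔻 → OnePoint ℂ} (hf : Continuous f) {γ : Set 𝔻}
    {ξ : ℂ} (hξ : ‖ξ‖ = 1) (hγ : IsSimpleCurveEndingAt γ ξ) {c : OnePoint ℂ}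
    (h : IsDeltaBoundaryValue f γ ξ c) : IsNormalAlong f γ := by
  intro F hF
  choose w hw hwF using hF
  obtain ⟨k, hk, hlim | ⟨v, hv⟩⟩ := hγ.exists_subseq_tendsto hw
  · refine ⟨k, hk, fun _ => c, ?_⟩
    simp only [← hwF]
    exact h.convergesLocally hξ (fun n => hw (k n)) hlim
  · refine ⟨k, hk, f ∘ mobius v, ?_⟩
    simp only [← hwF]
    exact convergesLocally_iff.2 (tendstoLocallyUniformly_comp_mobius hf hv)

end CurvilinearBoundary

end

theorem theorem6p1 (f : 𝔻 → OnePoint ℂ) (hf : CurvilinearBoundary.IsMeromorphic f)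
    (θ : ℝ) (γ : Set 𝔻)
    (hγ : CurvilinearBoundary.IsSimpleCurveEndingAt γ (Complex.exp (θ * Complex.I)))
    (c : OnePoint ℂ) :
    (CurvilinearBoundary.IsNormalAlong f γ ∧
      CurvilinearBoundary.HasAsymptoticValue f γ (Complex.exp (θ * Complex.I)) c) ↔
    CurvilinearBoundary.IsDeltaBoundaryValue f γ (Complex.exp (θ * Complex.I)) c := by
  have hξ := Complex.norm_exp_ofReal_mul_I θ
  exact ⟨fun h => CurvilinearBoundary.isDeltaBoundaryValue_of_isNormalAlong hf hξ hγ h.1 h.2,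
    fun h => ⟨h.isNormalAlong hf.1 hξ hγ, h.hasAsymptoticValue⟩⟩
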